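/- For integers $n\ge 1$ and $k\ge 3$ let $R_n(k)$ be the least $s>0$ such that every colouring of the edges of the complete graph $K_s$ with $n$ colours contains a monochromatic $K_k$. For a finite simple graph $G$ let $\alpha(G)$ be its independence number, let $G^n$ be the graph on $V(G)^n$ in which two distinct vertices $u,v$ are adjacent if and only if for every $i$ either $u_i=v_i$ or $u_iv_i\in E(G)$, and let $c(G)=\lim_{n\to\infty}\alpha(G^n)^{1/n}$ be its Shannon capacity. Then for every integer $k\ge 3$ the following hold. (a) The limit $\lim_{n\to\infty}R_n(k)^{1/n}$ exists in $[0,\infty]$, and for every integer $n_0\ge 1$, $$R_{n_0}(k)^{1/n_0}<\lim_{n\to\infty}R_n(k)^{1/n}.$$ (b) The supremum of the Shannon capacity over all finite graphs of independence number $k-1$ is not achieved by any finite graph power: for every finite graph $G$ with $\alpha(G)=k-1$ and every integer $n\ge 1$, $$\alpha(G^n)^{1/n}<\sup\{c(H): H \text{ a finite graph with } \alpha(H)=k-1\}\in[0,\infty].$$ The same holds with "independence number at most $k-1$" in place of "independence number $k-1$" throughout: for every finite graph $G$ with $\alpha(G)\le k-1$ and every $n\ge 1$, $\alpha(G^n)^{1/n}<\sup\{c(H):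 H \text{ a finite graph with } \alpha(H)\le k-1\}$. -/

import Mathlib

open Filter Topology
open scoped ENNReal

/-- An edge-colouring `C` of the complete graph on `V` with colours `Fin n` is a
`(k 0, …, k (n-1))`-colouring if for every colour `i` it has no complete subgraph on `k i`
vertices all of whose edges have colour `i`. -/
def IsRamseyColoring {V : Type*} {n : ℕ} (k : Fin n → ℕ)
    (C : SimpleGraph.TopEdgeLabeling V (Fin n)) : Prop :=
  ∀ i : Fin n, (SimpleGraph.EdgeLabeling.labelGraph C i).CliqueFree (k i)

/-- The multicolour Ramsey number `R(k 0, …, k (n-1))`: the least `s > 0` such that the complete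
graph on `s` vertices has no `(k 0, …, k (n-1))`-colouring. -/
noncomputable def ramseyNumber {n : ℕ} (k : Fin n → ℕ) : ℕ :=
  sInf {s : ℕ | 0 < s ∧
    ¬ ∃ C : SimpleGraph.TopEdgeLabeling (Fin s) (Fin n), IsRamseyColoring k C}

/-- The diagonal Ramsey number `R_n(k)` with `n` colours. -/
noncomputable def diagRamsey (n k : ℕ) : ℕ :=
  ramseyNumber (fun _ : Fin n => k)

/-- The product of a family of graphs: distinct vertices `u`, `v` are adjacent if and only if
in each coordinate they are equal or adjacent. -/
def graphProduct {ι : Type*} {V : ι → Type*} (G : ∀ i, SimpleGraph (V i)) :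
    SimpleGraph (∀ i, V i) where
  Adj u v := u ≠ v ∧ ∀ i, u i = v i ∨ (G i).Adj (u i) (v i)
  symm := ⟨fun _ _ h => ⟨h.1.symm, fun i => (h.2 i).imp Eq.symm fun a => a.symm⟩⟩
  loopless := ⟨fun _ h => h.1 rfl⟩

/-- The `n`-fold product `G × ⋯ × G`. -/
def graphPower {V : Type*} (G : SimpleGraph V) (n : ℕ) : SimpleGraph (Fin n → V) :=
  graphProduct fun _ : Fin n => G

/-- The quantity `α(G ^ n) ^ (1 / n)`. -/
noncomputable def indepRoot {V : Type*} (G : SimpleGraph V) (n : ℕ) : ℝ≥0∞ :=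
  ((graphPower G n).indepNum : ℝ≥0∞) ^ (1 / (n : ℝ))

/-- The Shannon capacity `c(G) = lim α(G ^ n) ^ (1 / n)` of a finite graph. The limit always
exists, since `n ↦ α(G ^ n)` is supermultiplicative and `α(G ^ n) ≤ |V| ^ n`. -/
noncomputable def shannonCapacity {V : Type*} (G : SimpleGraph V) : ℝ≥0∞ :=
  limUnder atTop (indepRoot G)

/-- The supremum in `[0, ∞]` of the Shannon capacity over all finite graphs whose independence
number is exactly `a`. -/
noncomputable def capacitySup (a : ℕ) : ℝ≥0∞ :=
  sSup {x | ∃ (V : Type) (_ : Finite V) (G : SimpleGraph V),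
    G.indepNum = a ∧ x = shannonCapacity G}

/-- The supremum in `[0, ∞]` of the Shannon capacity over all finite graphs whose independence
number is at most `a`. -/
noncomputable def capacitySupLE (a : ℕ) : ℝ≥0∞ :=
  sSup {x | ∃ (V : Type) (_ : Finite V) (G : SimpleGraph V),
    G.indepNum ≤ a ∧ x = shannonCapacity G}

/-! Replacing every vertex of one colouring by a copy of another, with disjoint palettes, multiplies
the numbers of vertices and adds the numbers of colours. The theorem rests on a slight gain in this
product. When `k ≥ 3`, an edge lying in no monochromatic triangle can be ignored, so its colour need
not come from either factor. Spending such edges makes room for twins of two vertices of the first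
factor: colourings on `a` and `b` vertices give one on `(a + 2) * b`
(`TwinProduct.monoCliqueFree_color`). With `a = R_n(k) - 1`, iteration gives `(R_n(k) + 1) ^ q <
R_{qn+2}(k)`, so the growth rate is at least `(R_n(k) + 1) ^ (1/n)`, which exceeds `R_n(k) ^ (1/n)`.

The twin product needs two colours in each factor. For `n = 1`, where `R_1(k) ≤ k`, colourings that
depend only on differences of integers take over: using `r` colours for the differences up to `S`
gives growth rate at least `(2S + 1) ^ (1/r)` (`HasDiffColoring.digits`), which beats `k` for
suitable `S` and `r`.

For Shannon capacity, an independent set in `G ^ n` yields an `n`-colouring without monochromatic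
`K_k`, so `α(G ^ n) < R_n(k)`. Conversely, an `n`-colouring on `s` vertices yields a graph of
independence number `k - 1` whose `n`-th power has an independent set of size `s` (`colorJoin`). The
supremum of the capacities is therefore at least every `(R_N(k) - 1) ^ (1/N)`, and the strict gain
carries over. -/

/-! ### Colourings without monochromatic cliques -/

/-- A symmetric function on pairs without monochromatic `k`-sets: a colouring of the edges of a
complete graph without monochromatic `K_k`, with irrelevant values on the diagonal. -/
structure MonoCliqueFree {α κ : Type*} (k : ℕ) (f : α → α → κ) : Prop where
  symm : ∀ x y, f x y = f y x
  free : ∀ (c : κ) (S : Finset α), S.card = k → ¬ ∀ x ∈ S, ∀ y ∈ S, x ≠ y → f x y = c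

/-- It suffices for a colouring to be monochromatic-clique-free that every edge of a
monochromatic triangle is, along a map into a clique-free colouring, an edge of a fixed colour. -/
lemma not_mono_of_triangle {α β κ μ : Type*} {k : ℕ} (hk : 3 ≤ k) {f : α → α → κ}
    {g : β → β → μ} (hg : MonoCliqueFree k g) (π : α → β) (c : κ) (d : μ)
    (h : ∀ x y z, x ≠ y → x ≠ z → y ≠ z → f x y = c → f x z = c → f y z = c →
      π x ≠ π y ∧ g (π x) (π y) = d)
    (S : Finset α) (hS : S.card = k) (hf : ∀ x ∈ S, ∀ y ∈ S, x ≠ y → f x y = c) : False := by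
  classical
  have key : ∀ x ∈ S, ∀ y ∈ S, x ≠ y → π x ≠ π y ∧ g (π x) (π y) = d := by
    intro x hx y hy hxy
    -- As `k ≥ 3`, a third vertex completes the edge to a monochromatic triangle.
    obtain ⟨z, hz⟩ : ((S.erase x).erase y).Nonempty := by
      rw [← Finset.card_pos, Finset.card_erase_of_mem (by simp [hy, hxy.symm]),
        Finset.card_erase_of_mem hx]
      omega
    simp only [Finset.mem_erase] at hz
    exact h x y z hxy (Ne.symm hz.2.1) (Ne.symm hz.1) (hf x hx y hy hxy)
      (hf x hx z hz.2.2 (Ne.symm hz.2.1)) (hf y hy z hz.2.2 (Ne.symm hz.1))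
  have inj : Set.InjOn π S := by
    intro x hx y hy hxy
    by_contra hne
    exact (key x hx y hy hne).1 hxy
  refine hg.free d (S.image π) (by rw [Finset.card_image_of_injOn inj, hS]) ?_
  intro a ha b hb hab
  obtain ⟨x, hx, rfl⟩ := Finset.mem_image.1 ha
  obtain ⟨y, hy, rfl⟩ := Finset.mem_image.1 hb
  exact (key x hx y hy (fun h => hab (h ▸ rfl))).2

/-! ### The twin product -/

namespace TwinProduct

/-- The part a vertex plays in the twin product: one of the two distinguished vertices, the added
twin of one of them, or any other vertex. -/
inductive Role
  | fst | fstTwin | snd | sndTwin | rest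

variable {I Q κ μ : Type*} [DecidableEq I] [DecidableEq Q] [DecidableEq κ] [DecidableEq μ]

/-- The role of a vertex, for distinguished vertices `p` and `q`. -/
def role (p q : I) : I ⊕ Bool → Role
  | .inl i => if i = p then .fst else if i = q then .snd else .rest
  | .inr false => .fstTwin
  | .inr true => .sndTwin

/-- The vertex of the original colouring that a vertex stands for. -/
def base (p q : I) : I ⊕ Bool → I
  | .inl i => i
  | .inr false => p
  | .inr true => q

/-- The colour of an edge as a function of the roles of its ends, the colour `a` of its first
projection, whether its second projection is trivial (`e`), and the colour `b` of its second
projection if it is not. -/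
def roleColor (c₀ c₁ : κ) (s t : μ) (same : Prop) [Decidable same] (e : Prop) [Decidable e]
    (a : κ) (b : μ) : Role → Role → κ ⊕ μ
  | .rest, .rest => if same then .inr b else .inl a
  | .fst, .fst | .fstTwin, .fstTwin | .snd, .snd | .sndTwin, .sndTwin => .inr b
  | .fst, .fstTwin | .fstTwin, .fst => if e then .inl c₀ else if b = s then .inl c₁ else .inr b
  | .snd, .sndTwin | .sndTwin, .snd => if e then .inl c₀ else if b = t then .inl c₁ else .inr b
  | .fst, .snd | .snd, .fst =>
    if e then .inl c₀ else if b = s ∨ b = t then .inl c₁ else .inr b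
  | .fst, .sndTwin | .sndTwin, .fst =>
    if e then .inr s else if b = s ∨ b = t then .inl c₀ else .inr b
  | .fstTwin, .snd | .snd, .fstTwin =>
    if e then .inr t else if b = s ∨ b = t then .inl c₀ else .inr b
  | .fstTwin, .sndTwin | .sndTwin, .fstTwin => if e then .inl c₀ else .inr b
  | .fst, .rest | .rest, .fst =>
    if a = c₀ then (if e then .inr s else if b = s then .inl a else .inr b)
    else if e then .inl a else .inr b
  | .snd, .rest | .rest, .snd =>
    if a = c₀ then (if e then .inr t else if b = t then .inl a else .inr b)
    else if e then .inl a else .inr b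
  | .fstTwin, .rest | .rest, .fstTwin => if e ∨ b = t then .inl a else .inr b
  | .sndTwin, .rest | .rest, .sndTwin => if e ∨ b = s then .inl a else .inr b

/-- The twin product of two colourings `A` and `B`: a colouring of the product of the vertex sets
with two more copies of the second. -/
def color (A : I → I → κ) (B : Q → Q → μ) (p q : I) (c₁ : κ) (s t : μ)
    (x y : (I ⊕ Bool) × Q) : κ ⊕ μ :=
  roleColor (A p q) c₁ s t (x.1 = y.1) (x.2 = y.2) (A (base p q x.1) (base p q y.1)) (B x.2 y.2)
    (role p q x.1) (role p q y.1)

variable {A : I → I → κ} {B : Q → Q → μ} {p q : I} {c₁ : κ} {s t : μ}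

lemma color_symm (hA : ∀ i j, A i j = A j i) (hB : ∀ i j, B i j = B j i)
    (x y : (I ⊕ Bool) × Q) : color A B p q c₁ s t x y = color A B p q c₁ s t y x := by
  unfold color
  rw [hA (base p q y.1), hB y.2]
  simp only [eq_comm (a := y.1), eq_comm (a := y.2)]
  cases role p q x.1 <;> cases role p q y.1 <;> rfl

/-- Reduction of a property of vertices to the five roles. -/
lemma cases_role (p q : I) {P : I ⊕ Bool → Prop} (hp : P (.inl p)) (hq : P (.inl q))
    (hp' : P (.inr false)) (hq' : P (.inr true))
    (hr : ∀ i, i ≠ p → i ≠ q → P (.inl i)) (x : I ⊕ Bool) : P x := by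
  rcases x with i | _ | _
  · by_cases h : i = p
    · exact h ▸ hp
    by_cases h' : i = q
    · exact h' ▸ hq
    exact hr i h h'
  exacts [hp', hq']

/-- An edge whose colour is not that of its projection lies in no monochromatic triangle.
Distinctness from `z` need not be assumed: diagonal values of `color` are always right colours. -/
lemma good_of_triangle_inl (hA : ∀ i j, A i j = A j i) (hB : ∀ i j, B i j = B j i)
    (hpq : p ≠ q) (hc : c₁ ≠ A p q) (hst : s ≠ t) {e : κ} (x y z : (I ⊕ Bool) × Q)
    (hxy : x ≠ y) (h : color A B p q c₁ s t x y = .inl e)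
    (h₁ : color A B p q c₁ s t x z = .inl e) (h₂ : color A B p q c₁ s t y z = .inl e) :
    base p q x.1 ≠ base p q y.1 ∧ A (base p q x.1) (base p q y.1) = e := by
  obtain ⟨x, b⟩ := x
  obtain ⟨y, b'⟩ := y
  obtain ⟨z, b''⟩ := z
  revert h h₁ h₂ hxy
  induction x using cases_role p q <;> induction y using cases_role p q <;>
  induction z using cases_role p q <;> intros <;>
    simp [color, roleColor, role, base, hpq.symm, *] at * <;> have := hA p q <;> grind

/-- The counterpart for the second factor. Here all three vertices must be assumed distinct, since
`B` takes arbitrary values on the diagonal. -/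
lemma good_of_triangle_inr (hA : ∀ i j, A i j = A j i) (hB : ∀ i j, B i j = B j i)
    (hpq : p ≠ q) (hc : c₁ ≠ A p q) (hst : s ≠ t) {d : μ} (x y z : (I ⊕ Bool) × Q)
    (hxy : x ≠ y) (hxz : x ≠ z) (hyz : y ≠ z) (h : color A B p q c₁ s t x y = .inr d)
    (h₁ : color A B p q c₁ s t x z = .inr d) (h₂ : color A B p q c₁ s t y z = .inr d) :
    x.2 ≠ y.2 ∧ B x.2 y.2 = d := by
  obtain ⟨x, b⟩ := x
  obtain ⟨y, b'⟩ := y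
  obtain ⟨z, b''⟩ := z
  revert h h₁ h₂ hxy hxz hyz
  induction x using cases_role p q <;> induction y using cases_role p q <;>
  induction z using cases_role p q <;> intros <;>
    simp [color, roleColor, role, base, hpq.symm, *] at * <;> have := hA p q <;> grind

theorem monoCliqueFree_color {k : ℕ} (hk : 3 ≤ k) (hA : MonoCliqueFree k A)
    (hB : MonoCliqueFree k B) (hpq : p ≠ q) (hc : c₁ ≠ A p q) (hst : s ≠ t) :
    MonoCliqueFree k (color A B p q c₁ s t) := by
  refine ⟨color_symm hA.symm hB.symm, ?_⟩
  rintro (e | d) S hS hf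
  · exact not_mono_of_triangle hk hA (fun x => base p q x.1) _ e
      (fun x y z hxy _ _ h h₁ h₂ => good_of_triangle_inl hA.symm hB.symm hpq hc hst x y z hxy h h₁ h₂)
      S hS hf
  · exact not_mono_of_triangle hk hB (fun x => x.2) _ d
      (fun x y z hxy hxz hyz h h₁ h₂ =>
        good_of_triangle_inr hA.symm hB.symm hpq hc hst x y z hxy hxz hyz h h₁ h₂)
      S hS hf

end TwinProduct

/-! ### Colourings with `n` colours and Ramsey numbers -/

/-- There is a colouring of the edges of `K_s` with `n` colours and no monochromatic `K_k`. -/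
def HasColoring (k n s : ℕ) : Prop :=
  ∃ C : SimpleGraph.TopEdgeLabeling (Fin s) (Fin n), IsRamseyColoring (fun _ => k) C

lemma MonoCliqueFree.hasColoring {α κ : Type*} [Fintype α] [Fintype κ] {k n s : ℕ} {f : α → α → κ}
    (hk : 2 ≤ k) (hf : MonoCliqueFree k f) (hn : Fintype.card κ ≤ n) (hs : s ≤ Fintype.card α) :
    HasColoring k n s := by
  obtain ⟨φ⟩ : Nonempty (Fin s ↪ α) := Function.Embedding.nonempty_of_card_le (by simpa)
  obtain ⟨ψ⟩ : Nonempty (κ ↪ Fin n) := Function.Embedding.nonempty_of_card_le (by simpa)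
  refine ⟨SimpleGraph.EdgeLabeling.mk (fun x y _ => ψ (f (φ x) (φ y)))
    fun x y _ => by rw [hf.symm], ?_⟩
  intro i T hT
  have adj : ∀ x ∈ T, ∀ y ∈ T, x ≠ y → ψ (f (φ x) (φ y)) = i := by
    intro x hx y hy hxy
    obtain ⟨_, h⟩ := (SimpleGraph.TopEdgeLabeling.labelGraph_adj x y).1 (hT.isClique hx hy hxy)
    exact h
  -- The embedding `ψ` need not be onto, so a preimage of `i` is read off from an edge of the
  -- clique; one exists because `k ≥ 2`.
  obtain ⟨x, hx, y, hy, hxy⟩ := Finset.one_lt_card.1 (hk.trans_eq hT.card_eq.symm)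
  refine hf.free (f (φ x) (φ y)) (T.map φ) (by rw [Finset.card_map, hT.card_eq]) ?_
  intro a ha b hb hab
  obtain ⟨a, ha', rfl⟩ := Finset.mem_map.1 ha
  obtain ⟨b, hb', rfl⟩ := Finset.mem_map.1 hb
  exact ψ.injective ((adj a ha' b hb' (fun h => hab (h ▸ rfl))).trans (adj x hx y hy hxy).symm)

lemma HasColoring.exists_monoCliqueFree {k n s : ℕ} (hn : 0 < n) (h : HasColoring k n s) :
    ∃ f : Fin s → Fin s → Fin n, MonoCliqueFree k f := by
  obtain ⟨C, hC⟩ := h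
  refine ⟨fun x y => if h : x ≠ y then C.get x y h else ⟨0, hn⟩, ⟨?_, ?_⟩⟩
  · intro x y
    by_cases h : x = y
    · rw [h]
    · simp only [ne_eq, h, Ne.symm h, not_false_eq_true, dite_true]
      exact SimpleGraph.EdgeLabeling.get_comm _ _ _
  · intro c S hS hf
    refine hC c S ⟨?_, hS⟩
    intro x hx y hy hxy
    refine (SimpleGraph.TopEdgeLabeling.labelGraph_adj x y).2 ⟨hxy, ?_⟩
    simpa [hxy] using hf x hx y hy hxy

lemma HasColoring.mono {k n s n' s' : ℕ} (hk : 2 ≤ k) (h : HasColoring k n s) (hn : 0 < n) (hn' : n ≤ n')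
    (hs : s' ≤ s) : HasColoring k n' s' := by
  obtain ⟨f, hf⟩ := h.exists_monoCliqueFree hn
  exact hf.hasColoring hk (by simpa) (by simpa)

/-- Any `n ≥ 2` colours contribute two more than the size of a colouring with these colours. -/
lemma HasColoring.twin {k n m a b : ℕ} (hk : 3 ≤ k) (hn : 2 ≤ n) (hm : 2 ≤ m) (ha : 2 ≤ a)
    (hA : HasColoring k n a) (hB : HasColoring k m b) : HasColoring k (n + m) ((a + 2) * b) := by
  obtain ⟨A, hA⟩ := hA.exists_monoCliqueFree (by omega)
  obtain ⟨B, hB⟩ := hB.exists_monoCliqueFree (by omega)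
  have : Nontrivial (Fin n) := Fin.nontrivial_iff_two_le.2 hn
  have : Nontrivial (Fin m) := Fin.nontrivial_iff_two_le.2 hm
  have : Nontrivial (Fin a) := Fin.nontrivial_iff_two_le.2 ha
  obtain ⟨p, q, hpq⟩ := exists_pair_ne (Fin a)
  obtain ⟨s, t, hst⟩ := exists_pair_ne (Fin m)
  obtain ⟨c₁, hc⟩ := exists_ne (A p q)
  exact (TwinProduct.monoCliqueFree_color hk hA hB hpq hc hst).hasColoring
    (by omega) (by simp) (by simp)

/-- Ramsey's theorem for several colours. -/
theorem exists_mono_of_le_card {n : ℕ} (hn : 0 < n) (N : ℕ) : ∀ l : Fin n → ℕ, ∑ i, l i = N →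
    ∃ s : ℕ, ∀ (α : Type) (f : α → α → Fin n), (∀ x y, f x y = f y x) →
      ∀ S : Finset α, s ≤ S.card →
        ∃ i, ∃ T ⊆ S, T.card = l i ∧ ∀ x ∈ T, ∀ y ∈ T, x ≠ y → f x y = i := by
  classical
  induction N with
  | zero =>
    intro l hl
    refine ⟨0, fun α f _ S _ => ⟨⟨0, hn⟩, ∅, by simp, ?_, by simp⟩⟩
    have := (Finset.sum_eq_zero_iff.1 hl) ⟨0, hn⟩ (Finset.mem_univ _)
    simp [this]
  | succ N ih =>
    intro l hl
    by_cases h0 : ∃ i, l i = 0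
    · obtain ⟨i, hi⟩ := h0
      exact ⟨0, fun α f _ S _ => ⟨i, ∅, by simp, by simp [hi], by simp⟩⟩
    push Not at h0
    have step : ∀ i, ∑ j, Function.update l i (l i - 1) j = N := by
      intro i
      have h1 := Finset.sum_update_of_mem (Finset.mem_univ i) l (l i - 1)
      have h2 := Finset.add_sum_erase Finset.univ l (Finset.mem_univ i)
      have := h0 i
      rw [Finset.sdiff_singleton_eq_erase] at h1
      omega
    choose s hs using fun i => ih _ (step i)
    -- Remove one vertex `v`. By pigeonhole some colour `i` joins `v` to at least `s i` of the
    -- others, among which a clique of colour `i` may be one vertex smaller, as `v` extends it.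
    refine ⟨1 + ∑ i, s i, fun α f hf S hS => ?_⟩
    obtain ⟨v, hv⟩ : S.Nonempty := Finset.card_pos.1 (by omega)
    have hcard := Finset.card_eq_sum_card_fiberwise (f := f v) (s := S.erase v)
      (t := Finset.univ) (by simp)
    rw [Finset.card_erase_of_mem hv] at hcard
    have hle : ∑ i, s i ≤ ∑ i, ((S.erase v).filter (fun x => f v x = i)).card := by
      rw [← hcard]; omega
    obtain ⟨i, -, hi⟩ := Finset.exists_le_of_sum_le ⟨⟨0, hn⟩, Finset.mem_univ _⟩ hle
    obtain ⟨j, T, hTS, hT, hmono⟩ := hs i α f hf _ hi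
    have hTv : ∀ x ∈ T, x ≠ v ∧ x ∈ S ∧ f v x = i := by
      intro x hx
      simpa [and_assoc] using hTS hx
    by_cases hij : j = i
    · subst hij
      refine ⟨j, insert v T, ?_, ?_, ?_⟩
      · exact Finset.insert_subset hv fun x hx => (hTv x hx).2.1
      · rw [Finset.card_insert_of_notMem fun h => (hTv v h).1 rfl, hT, Function.update_self]
        have := h0 j
        omega
      · intro x hx y hy hxy
        rcases Finset.mem_insert.1 hx with rfl | hx' <;>
          rcases Finset.mem_insert.1 hy with rfl | hy'
        · exact absurd rfl hxy
        · exact (hTv y hy').2.2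
        · rw [hf]; exact (hTv x hx').2.2
        · exact hmono x hx' y hy' hxy
    · exact ⟨j, T, fun x hx => (hTv x hx).2.1, by rw [hT, Function.update_of_ne hij], hmono⟩

/-- This ensures that the infimum defining the Ramsey number is attained and is not the default
value `0`. -/
lemma exists_not_hasColoring {k n : ℕ} (hn : 0 < n) : ∃ s, 0 < s ∧ ¬ HasColoring k n s := by
  obtain ⟨s, hs⟩ := exists_mono_of_le_card hn _ (fun _ : Fin n => k) rfl
  refine ⟨s + 1, by omega, fun h => ?_⟩
  obtain ⟨f, hf⟩ := h.exists_monoCliqueFree hn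
  obtain ⟨i, T, -, hT, hmono⟩ := hs _ f hf.symm Finset.univ (by simp)
  exact hf.free i T hT hmono

lemma diagRamsey_le {n k s : ℕ} (hs : 0 < s) (h : ¬ HasColoring k n s) : diagRamsey n k ≤ s :=
  Nat.sInf_le ⟨hs, h⟩

lemma HasColoring.lt_diagRamsey {n k s : ℕ} (hn : 0 < n) (hk : 2 ≤ k) (h : HasColoring k n s) :
    s < diagRamsey n k := by
  have hmem := Nat.sInf_mem (s := {s | 0 < s ∧ ¬ HasColoring k n s}) (exists_not_hasColoring hn)
  by_contra! hle
  exact hmem.2 (h.mono hk hn le_rfl hle)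

lemma one_lt_diagRamsey {n k : ℕ} (hn : 0 < n) (hk : 2 ≤ k) : 1 < diagRamsey n k := by
  have hf : MonoCliqueFree k (fun _ _ : Fin 1 => (⟨0, hn⟩ : Fin n)) :=
    ⟨fun _ _ => rfl, fun c S hS _ => by
      have := S.card_le_univ
      rw [Fintype.card_fin] at this
      omega⟩
  exact (hf.hasColoring hk (by simp) (by simp)).lt_diagRamsey hn hk

lemma hasColoring_pred_diagRamsey {n k : ℕ} (hn : 0 < n) (hk : 2 ≤ k) :
    HasColoring k n (diagRamsey n k - 1) := by
  by_contra h
  have h1 := one_lt_diagRamsey hn hk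
  have := diagRamsey_le (by omega) h
  omega

lemma diagRamsey_mono {k n m : ℕ} (hn : 0 < n) (hk : 2 ≤ k) (hnm : n ≤ m) :
    diagRamsey n k ≤ diagRamsey m k := by
  have := ((hasColoring_pred_diagRamsey hn hk).mono hk hn hnm le_rfl).lt_diagRamsey (by omega) hk
  omega

lemma diagRamsey_one_le {k : ℕ} (hk : 0 < k) : diagRamsey 1 k ≤ k := by
  refine diagRamsey_le hk fun h => ?_
  obtain ⟨f, hf⟩ := h.exists_monoCliqueFree one_pos
  exact hf.free 0 Finset.univ (by simp) fun _ _ _ _ _ => Subsingleton.elim _ _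

/-- Powers of `R_n(k) + 1` bound Ramsey numbers from below. -/
lemma pow_lt_diagRamsey {k n : ℕ} (hk : 3 ≤ k) (hn : 2 ≤ n) (q : ℕ) :
    (diagRamsey n k + 1) ^ q < diagRamsey (q * n + 2) k := by
  induction q with
  -- The offset `2` in the number of colours guarantees two colours in the second factor of every
  -- twin product.
  | zero => simpa using one_lt_diagRamsey (n := 2) (by norm_num) (by omega)
  | succ q ih =>
    have h3 : 2 ≤ diagRamsey n k - 1 := by
      have hf : MonoCliqueFree k (fun _ _ : Fin 2 => (⟨0, by omega⟩ : Fin n)) :=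
        ⟨fun _ _ => rfl, fun c S hS _ => by
          have := S.card_le_univ
          rw [Fintype.card_fin] at this
          omega⟩
      have := (hf.hasColoring (n := n) (s := 2) (by omega) (by simp) (by simp)).lt_diagRamsey
        (by omega) (by omega)
      omega
    have h := (HasColoring.twin hk hn (by omega : 2 ≤ q * n + 2) h3
      (hasColoring_pred_diagRamsey (by omega) (by omega))
      (hasColoring_pred_diagRamsey (by omega) (by omega))).lt_diagRamsey (by omega) (by omega)
    have e1 : diagRamsey n k - 1 + 2 = diagRamsey n k + 1 := by omega
    rw [e1, show n + (q * n + 2) = (q + 1) * n + 2 by ring] at h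
    refine lt_of_le_of_lt ?_ h
    rw [pow_succ, mul_comm]
    exact Nat.mul_le_mul_left _ (by omega)

/-! ### Colourings by differences -/

/-- The differences `1, …, N` can be coloured with `n` colours so that no `k` integers have all
their differences in the same colour class. -/
def HasDiffColoring (k N n : ℕ) : Prop :=
  ∃ c : ℕ → ℕ, (∀ d, 0 < d → d ≤ N → c d < n) ∧
    ∀ (i : ℕ) (T : Finset ℕ), T.card = k →
      ¬ ∀ x ∈ T, ∀ y ∈ T, x < y → y - x ≤ N ∧ c (y - x) = i

lemma HasDiffColoring.hasColoring {k N n : ℕ} (hk : 2 ≤ k) (hn : 0 < n)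
    (h : HasDiffColoring k N n) : HasColoring k n (N + 1) := by
  obtain ⟨c, hc, hfree⟩ := h
  have hf : MonoCliqueFree k (fun x y : Fin (N + 1) =>
      if h : c (Nat.dist x y) < n then (⟨_, h⟩ : Fin n) else ⟨0, hn⟩) := by
    refine ⟨fun x y => by simp only [Nat.dist_comm], fun i S hS hf => ?_⟩
    refine hfree i (S.map Fin.valEmbedding) (by simpa) ?_
    intro x hx y hy hxy
    obtain ⟨x, hx', rfl⟩ := Finset.mem_map.1 hx
    obtain ⟨y, hy', rfl⟩ := Finset.mem_map.1 hy
    simp only [Fin.valEmbedding_apply] at hxy ⊢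
    have hd : Nat.dist x y = y - x := Nat.dist_eq_sub_of_le hxy.le
    have hle : (y : ℕ) - x ≤ N := by omega
    have := hf x hx' y hy' (fun h => by simp [h] at hxy)
    rw [hd, dif_pos (hc _ (by omega) hle)] at this
    exact ⟨hle, congrArg Fin.val this⟩
  exact hf.hasColoring hk (by simp) (by simp)

/-- Translating the least element of a set of integers to `0` and applying a map which is
additive on differences preserves the pattern of differences. -/
lemma HasDiffColoring.not_mono_of_additive {k N : ℕ} {c : ℕ → ℕ} (hk : 0 < k) {i : ℕ}
    (hfree : ∀ T : Finset ℕ, T.card = k → ¬ ∀ x ∈ T, ∀ y ∈ T, x < y → y - x ≤ N ∧ c (y - x) = i)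
    (D : ℕ → Prop) (g : ℕ → ℕ)
    (hadd : ∀ d e, D d → D e → D (d + e) → g (d + e) = g d + g e)
    (hpos : ∀ d, D d → 0 < g d) (hN : ∀ d, D d → g d ≤ N) (hc : ∀ d, D d → c (g d) = i)
    (T : Finset ℕ) (hT : T.card = k) (hD : ∀ x ∈ T, ∀ y ∈ T, x < y → D (y - x)) : False := by
  have hne : T.Nonempty := Finset.card_pos.1 (by omega)
  set m := T.min' hne with hm
  have hmT : m ∈ T := T.min'_mem hne
  have hmle : ∀ x ∈ T, m ≤ x := fun x hx => T.min'_le x hx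
  -- The value at `m` is fixed separately, since nothing is known about `g 0`.
  let φ : ℕ → ℕ := fun x => if x = m then 0 else g (x - m)
  have key : ∀ x ∈ T, ∀ y ∈ T, x < y → φ y = φ x + g (y - x) := by
    intro x hx y hy hxy
    have hym : y ≠ m := by have := hmle x hx; omega
    simp only [φ, hym, if_false]
    split_ifs with hxm
    · rw [hxm, zero_add]
    · have hmx : m < x := lt_of_le_of_ne (hmle x hx) (Ne.symm hxm)
      have e : y - m = (x - m) + (y - x) := by omega
      rw [e, hadd _ _ (hD m hmT x hx hmx) (hD x hx y hy hxy)]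
      rw [← e]
      exact hD m hmT y hy (hmx.trans hxy)
  have hlt : ∀ x ∈ T, ∀ y ∈ T, x < y → φ x < φ y := by
    intro x hx y hy hxy
    have := key x hx y hy hxy
    have := hpos _ (hD x hx y hy hxy)
    omega
  have hinj : Set.InjOn φ T := by
    intro x hx y hy hxy
    rcases lt_trichotomy x y with h | h | h
    · have := hlt x hx y hy h; omega
    · exact h
    · have := hlt y hy x hx h; omega
  refine hfree (T.image φ) (by rw [Finset.card_image_of_injOn hinj, hT]) ?_
  intro a ha b hb hab
  obtain ⟨x, hx, rfl⟩ := Finset.mem_image.1 ha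
  obtain ⟨y, hy, rfl⟩ := Finset.mem_image.1 hb
  have hxy : x < y := by
    rcases lt_trichotomy x y with h | h | h
    · exact h
    · rw [h] at hab; omega
    · have := hlt y hy x hx h; omega
  have e : φ y - φ x = g (y - x) := by
    have := key x hx y hy hxy
    omega
  rw [e]
  exact ⟨hN _ (hD x hx y hy hxy), hc _ (hD x hx y hy hxy)⟩

/-- Write differences in base `b = 2S + 1` with balanced residues in `[-S, S]`. A positive residue
determines the colour by itself; otherwise the rounded quotient `(d + S) / b` does. Two residues in
`[1, S]` add up without carry. If `d`, `e` and `d + e` all have residues in `[-S, 0]`, the residues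
add up exactly, hence so do the quotients. Each kind of colour class thus maps additively into one
of the given colourings. -/
lemma HasDiffColoring.digits {k S N r n : ℕ} (hk : 0 < k) (hS : HasDiffColoring k S r)
    (hN : HasDiffColoring k N n) : HasDiffColoring k ((2 * S + 1) * N + S) (r + n) := by
  obtain ⟨c, hc, hcf⟩ := hS
  obtain ⟨c', hc', hcf'⟩ := hN
  set b := 2 * S + 1 with hb
  let low : ℕ → Prop := fun d => 0 < d % b ∧ d % b ≤ S
  have hhigh : ∀ d, ¬ low d → (d + S) % b ≤ S := by
    intro d hd
    have h1 : d % b < b := Nat.mod_lt _ (by omega)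
    rw [Nat.add_mod, Nat.mod_eq_of_lt (show S < b by omega)]
    by_cases h0 : d % b = 0
    · rw [h0, zero_add, Nat.mod_eq_of_lt (show S < b by omega)]
    · have h2 : S < d % b := by
        by_contra h
        exact hd ⟨by omega, by omega⟩
      rw [Nat.mod_eq_sub_mod (by omega), Nat.mod_eq_of_lt (by omega)]
      omega
  have hquot : ∀ d, 0 < d → d ≤ b * N + S → ¬ low d → 0 < (d + S) / b ∧ (d + S) / b ≤ N := by
    intro d h0 hd hlow
    have h1 : (d + S) % b ≤ S := hhigh d hlow
    have h2 := Nat.div_add_mod (d + S) b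
    constructor
    · by_contra h
      have : (d + S) / b = 0 := Nat.eq_zero_of_not_pos h
      rw [this] at h2
      omega
    · rw [← Nat.lt_succ_iff, Nat.div_lt_iff_lt_mul (by omega), Nat.succ_mul, mul_comm]
      omega
  classical
  refine ⟨fun d => if low d then c (d % b) else r + c' ((d + S) / b), ?_, ?_⟩
  · intro d h0 hd
    dsimp only
    split_ifs with h
    · have := hc (d % b) h.1 h.2
      omega
    · have := hquot d h0 hd h
      have := hc' _ this.1 this.2
      omega
  · intro i T hT hmono
    have hk2 : ∀ d, low d → c (d % b) < r := fun d h => hc _ h.1 h.2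
    by_cases hi : i < r
    · have hlow : ∀ x ∈ T, ∀ y ∈ T, x < y → low (y - x) ∧ c ((y - x) % b) = i := by
        intro x hx y hy hxy
        have := (hmono x hx y hy hxy).2
        dsimp only at this
        split_ifs at this with h
        · exact ⟨h, this⟩
        · omega
      refine HasDiffColoring.not_mono_of_additive hk (hcf i)
        (fun d => low d ∧ c (d % b) = i) (fun d => d % b) ?_ (fun d h => h.1.1)
        (fun d h => h.1.2) (fun d h => h.2) T hT hlow
      rintro d e ⟨hd, -⟩ ⟨he, -⟩ -
      rw [Nat.add_mod, Nat.mod_eq_of_lt]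
      have := hd.2
      have := he.2
      omega
    · have hup : ∀ x ∈ T, ∀ y ∈ T, x < y →
          0 < y - x ∧ y - x ≤ b * N + S ∧ ¬ low (y - x) ∧ c' ((y - x + S) / b) = i - r := by
        intro x hx y hy hxy
        obtain ⟨h1, h2⟩ := hmono x hx y hy hxy
        dsimp only at h2
        split_ifs at h2 with h
        · have := hk2 _ h
          omega
        · exact ⟨by omega, h1, h, by omega⟩
      refine HasDiffColoring.not_mono_of_additive hk (hcf' (i - r))
        (fun d => 0 < d ∧ d ≤ b * N + S ∧ ¬ low d ∧ c' ((d + S) / b) = i - r)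
        (fun d => (d + S) / b) ?_ (fun d h => (hquot d h.1 h.2.1 h.2.2.1).1)
        (fun d h => (hquot d h.1 h.2.1 h.2.2.1).2) (fun d h => h.2.2.2) T hT hup
      rintro d e ⟨-, -, hd, -⟩ ⟨-, -, he, -⟩ ⟨-, -, hde, -⟩
      have h1 := hhigh d hd
      have h2 := hhigh e he
      have h3 := hhigh _ hde
      have e1 := Nat.div_add_mod (d + S) b
      have e2 := Nat.div_add_mod (e + S) b
      have e3 : d + e + S + S = b * ((d + S) / b + (e + S) / b) + ((d + S) % b + (e + S) % b) := by
        rw [mul_add]; omega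
      -- If the shifted residues summed to less than `S`, a unit borrowed from the quotient would
      -- make the shifted residue of `d + e` at least `S + 1`, contrary to `h3`.
      have h4 : S ≤ (d + S) % b + (e + S) % b := by
        by_contra h
        have hlt : (d + S) % b + (e + S) % b < S := by omega
        have hpos : 0 < (d + S) / b + (e + S) / b := by
          by_contra h0
          rw [Nat.eq_zero_of_not_pos h0] at e3
          omega
        obtain ⟨a, ha⟩ : ∃ a, (d + S) / b + (e + S) / b = a + 1 := ⟨_, (Nat.succ_pred_eq_of_pos hpos).symm⟩
        rw [ha, mul_add, mul_one] at e3
        have e4 : d + e + S = b * a + (S + 1 + ((d + S) % b + (e + S) % b)) := by omega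
        rw [e4, Nat.mul_add_mod, Nat.mod_eq_of_lt (by omega)] at h3
        omega
      have e4 : d + e + S = b * ((d + S) / b + (e + S) / b) +
          ((d + S) % b + (e + S) % b - S) := by omega
      have e5 : ((d + S) % b + (e + S) % b - S) / b = 0 := Nat.div_eq_of_lt (by omega)
      show (d + e + S) / b = _
      rw [e4, Nat.mul_add_div (by omega), e5, add_zero]

/-- Iterated difference colourings. -/
lemma HasDiffColoring.pow_lt_diagRamsey {k S r : ℕ} (hk : 3 ≤ k) (h : HasDiffColoring k S r)
    (q : ℕ) : (2 * S + 1) ^ q < diagRamsey (q * r + 1) k := by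
  -- For `N' = (2S + 1) N + S` one has `2N' + 1 = (2S + 1)(2N + 1)`. The start is one colour for the
  -- single difference `1`, where `2N + 1 = 3`; this is the extra colour in `q * r + 1`.
  have key : ∀ q, ∃ N, (2 * S + 1) ^ q ≤ N ∧ 2 * N + 1 = 3 * (2 * S + 1) ^ q ∧
      HasDiffColoring k N (q * r + 1) := by
    intro q
    induction q with
    | zero =>
      refine ⟨1, by simp, by simp, fun _ => 0, by simp, fun i T hT hmono => ?_⟩
      obtain ⟨x, y, z, hx, hy, hz, hxy, hyz⟩ : ∃ x y z, x ∈ T ∧ y ∈ T ∧ z ∈ T ∧ x < y ∧ y < z :=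
        ⟨T.orderEmbOfFin hT ⟨0, by omega⟩, T.orderEmbOfFin hT ⟨1, by omega⟩,
          T.orderEmbOfFin hT ⟨2, by omega⟩, by simp, by simp, by simp, by simp, by simp⟩
      have := (hmono x hx z hz (hxy.trans hyz)).1
      omega
    | succ q ih =>
      obtain ⟨N, hN, hN', hcol⟩ := ih
      refine ⟨(2 * S + 1) * N + S, ?_, ?_, ?_⟩
      · rw [pow_succ]
        nlinarith
      · rw [pow_succ]
        nlinarith
      · have := h.digits (by omega) hcol
        rwa [show r + (q * r + 1) = (q + 1) * r + 1 by ring] at this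
  obtain ⟨N, hN, -, hcol⟩ := key q
  have := (hcol.hasColoring (by omega) (by omega)).lt_diagRamsey (by omega) (by omega)
  omega

/-- Fewer than `k` integers have all their differences at most `k - 2`. -/
lemma hasDiffColoring_one {k : ℕ} (hk : 2 ≤ k) : HasDiffColoring k (k - 2) 1 := by
  refine ⟨fun _ => 0, by simp, fun i T hT hmono => ?_⟩
  have hne : T.Nonempty := Finset.card_pos.1 (by omega)
  have hsub : T ⊆ Finset.Icc (T.min' hne) (T.min' hne + (k - 2)) := by
    intro x hx
    have h1 := T.min'_le x hx
    rcases h1.eq_or_lt with h | h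
    · simp [← h]
    · have := (hmono _ (T.min'_mem hne) x hx h).1
      rw [Finset.mem_Icc]
      omega
  have := Finset.card_le_card hsub
  rw [Nat.card_Icc] at this
  omega

/-- A partition of `{1, …, 44}` into four sum-free sets. -/
def schurColor (d : ℕ) : ℕ :=
  if d ∈ [1, 3, 5, 15, 17, 19, 26, 28, 40, 42, 44] then 0
  else if d ∈ [2, 7, 8, 18, 21, 24, 27, 37, 38, 43] then 1
  else if d ∈ [4, 6, 13, 20, 22, 23, 25, 30, 32, 39, 41] then 2
  else 3

lemma schurColor_sumFree : ∀ a b : Fin 45, 0 < a.1 ∧ 0 < b.1 ∧ a.1 + b.1 < 45 ∧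
    schurColor a = schurColor b → ¬ schurColor (a.1 + b.1) = schurColor a := by
  decide +kernel

/-- For `x < y < z` the difference `z - x` is the sum of the other two, so sum-free classes contain
no triangle. Four classes are used because `2 * 44 + 1 = 89` exceeds `3 ^ 4 = 81`, whereas the best
partitions into one, two or three sum-free sets, reaching `1`, `4` and `13`, give exactly `3`, `3 ^
2` and `3 ^ 3`. -/
lemma hasDiffColoring_three : HasDiffColoring 3 44 4 := by
  refine ⟨schurColor, fun d _ _ => ?_, fun i T hT hmono => ?_⟩
  · unfold schurColor
    split_ifs <;> norm_num
  · obtain ⟨x, y, z, hx, hy, hz, hxy, hyz⟩ : ∃ x y z, x ∈ T ∧ y ∈ T ∧ z ∈ T ∧ x < y ∧ y < z :=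
      ⟨T.orderEmbOfFin hT 0, T.orderEmbOfFin hT 1,
        T.orderEmbOfFin hT 2, by simp, by simp, by simp, by simp, by simp⟩
    obtain ⟨h1, e1⟩ := hmono x hx y hy hxy
    obtain ⟨h2, e2⟩ := hmono y hy z hz hyz
    obtain ⟨h3, e3⟩ := hmono x hx z hz (hxy.trans hyz)
    rw [show z - x = (y - x) + (z - y) by omega] at e3
    exact schurColor_sumFree ⟨y - x, by omega⟩ ⟨z - y, by omega⟩
      ⟨by simpa using hxy, by simpa using hyz, by simp only; omega, e1.trans e2.symm⟩
      (e3.trans e1.symm)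

/-! ### Growth rates -/

lemma tendsto_sub_div_div (n e : ℕ) (hn : 0 < n) :
    Tendsto (fun N : ℕ => (((N - e) / n : ℕ) : ℝ) * (1 / (N : ℝ))) atTop (𝓝 (1 / (n : ℝ))) := by
  have hn' : (0 : ℝ) < n := by exact_mod_cast hn
  have hlow : Tendsto (fun N : ℕ => 1 / (n : ℝ) - ((e : ℝ) / n + 1) / (N : ℝ)) atTop
      (𝓝 (1 / (n : ℝ))) := by
    simpa using tendsto_const_nhds.sub (tendsto_const_div_atTop_nhds_zero_nat ((e : ℝ) / n + 1))
  refine tendsto_of_tendsto_of_tendsto_of_le_of_le' hlow tendsto_const_nhds ?_ ?_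
  · filter_upwards [eventually_ge_atTop (e + 1)] with N hN
    have hN' : (0 : ℝ) < N := by exact_mod_cast (by omega : 0 < N)
    have h1 : N < ((N - e) / n + 1) * n + e := by
      have := Nat.lt_div_mul_add (a := N - e) hn
      rw [add_mul]
      omega
    have h2 : (N : ℝ) < (((N - e) / n : ℕ) + 1) * n + e := by exact_mod_cast h1
    rw [mul_one_div, sub_le_iff_le_add, ← add_div, div_le_div_iff₀ hn' hN']
    have h3 : (e : ℝ) / n * n = e := div_mul_cancel₀ _ hn'.ne'
    nlinarith
  · filter_upwards [eventually_ge_atTop 1] with N hN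
    have hN' : (0 : ℝ) < N := by exact_mod_cast hN
    have h1 : (N - e) / n * n ≤ N := (Nat.div_mul_le_self _ _).trans (Nat.sub_le _ _)
    have h2 : (((N - e) / n : ℕ) : ℝ) * n ≤ N := by exact_mod_cast h1
    rw [mul_one_div, div_le_div_iff₀ hN' hn']
    linarith

/-- A sequence that dominates the powers of `C` along an arithmetic progression of step `n` has
`N`-th roots of its terms eventually above any number below the `n`-th root of `C`. -/
lemma eventually_lt_rpow {a : ℕ → ℕ} {C n e : ℕ} (hn : 0 < n)
    (h : ∀ q N, q * n + e ≤ N → C ^ q ≤ a N) {c : ℝ≥0∞} (hc : c < (C : ℝ≥0∞) ^ (1 / (n : ℝ))) :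
    ∀ᶠ N in atTop, c < (a N : ℝ≥0∞) ^ (1 / (N : ℝ)) := by
  have hn' : (0 : ℝ) < 1 / n := by positivity
  have hC : C ≠ 0 := by
    rintro rfl
    rw [Nat.cast_zero, ENNReal.zero_rpow_of_pos hn'] at hc
    exact not_lt_zero hc
  have hlim : Tendsto (fun N : ℕ => (C : ℝ≥0∞) ^ ((((N - e) / n : ℕ) : ℝ) * (1 / (N : ℝ)))) atTop
      (𝓝 ((C : ℝ≥0∞) ^ (1 / (n : ℝ)))) := by
    have h1 : Tendsto (fun N : ℕ => (C : ℝ) ^ ((((N - e) / n : ℕ) : ℝ) * (1 / (N : ℝ)))) atTop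
        (𝓝 ((C : ℝ) ^ (1 / (n : ℝ)))) :=
      ((Real.continuous_const_rpow (by exact_mod_cast hC)).tendsto _).comp
        (tendsto_sub_div_div n e hn)
    have h2 := ENNReal.tendsto_ofReal h1
    have h3 : ∀ x : ℝ, ENNReal.ofReal ((C : ℝ) ^ x) = (C : ℝ≥0∞) ^ x := fun x => by
      rw [← ENNReal.ofReal_rpow_of_pos (by positivity), ENNReal.ofReal_natCast]
    simpa only [h3] using h2
  filter_upwards [hlim.eventually_const_lt hc, eventually_ge_atTop e] with N hN hNe
  refine hN.trans_le ?_
  rw [ENNReal.rpow_mul, ENNReal.rpow_natCast]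
  refine ENNReal.rpow_le_rpow ?_ (by positivity)
  have := h ((N - e) / n) N (by have := Nat.div_mul_le_self (N - e) n; omega)
  exact_mod_cast this

/-- The strict gain, in the form used for both Ramsey numbers and capacities. Two or more colours
use the twin product. One colour uses differences: with `S = k - 2` the base `2k - 3` exceeds `k`
only for `k ≥ 4`, so `k = 3` needs the Schur partition. -/
lemma exists_pow_lt_diagRamsey {k n : ℕ} (hk : 3 ≤ k) (hn : 0 < n) :
    ∃ C m e : ℕ, 0 < m ∧
      (diagRamsey n k : ℝ≥0∞) ^ (1 / (n : ℝ)) < (C : ℝ≥0∞) ^ (1 / (m : ℝ)) ∧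
      ∀ q N, q * m + e ≤ N → C ^ q < diagRamsey N k := by
  have up : ∀ {C m e : ℕ}, 0 < e → (∀ q, C ^ q < diagRamsey (q * m + e) k) →
      ∀ q N, q * m + e ≤ N → C ^ q < diagRamsey N k := fun he h q N hN =>
    (h q).trans_le (diagRamsey_mono (by omega) (by omega) hN)
  rcases (by omega : 2 ≤ n ∨ n = 1) with hn2 | rfl
  · refine ⟨diagRamsey n k + 1, n, 2, hn, ?_, up (by norm_num) (pow_lt_diagRamsey hk hn2)⟩
    refine ENNReal.rpow_lt_rpow ?_ (by positivity)
    exact_mod_cast Nat.lt_succ_self _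
  have h1 : (diagRamsey 1 k : ℝ≥0∞) ^ (1 / ((1 : ℕ) : ℝ)) ≤ k := by
    simpa using diagRamsey_one_le (by omega)
  rcases hk.eq_or_lt with rfl | hk4
  · refine ⟨2 * 44 + 1, 4, 1, by norm_num, h1.trans_lt ?_,
      up (by norm_num) (hasDiffColoring_three.pow_lt_diagRamsey hk)⟩
    rw [one_div, ENNReal.lt_rpow_inv_iff (by norm_num)]
    norm_num
  · refine ⟨2 * (k - 2) + 1, 1, 1, by norm_num, h1.trans_lt ?_,
      up (by norm_num) ((hasDiffColoring_one (by omega)).pow_lt_diagRamsey hk)⟩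
    rw [Nat.cast_one, div_one, ENNReal.rpow_one]
    exact_mod_cast (by omega : k < 2 * (k - 2) + 1)

/-- This plays the role of Fekete's lemma. The supremum omits index `0`, where the exponent `1 / n`
of the roots considered here is meaningless. -/
lemma tendsto_iSup_of_eventually_lt {r : ℕ → ℝ≥0∞}
    (h : ∀ n, 0 < n → ∀ c < r n, ∀ᶠ N in atTop, c < r N) :
    Tendsto r atTop (𝓝 (⨆ n, r (n + 1))) := by
  refine tendsto_order.2 ⟨fun c hc => ?_, fun c hc => ?_⟩
  · obtain ⟨n, hn⟩ := lt_iSup_iff.1 hc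
    exact h (n + 1) n.succ_pos c hn
  · filter_upwards [eventually_ge_atTop 1] with N hN
    obtain ⟨n, rfl⟩ := Nat.exists_eq_add_of_le' hN
    exact (le_iSup (fun n => r (n + 1)) n).trans_lt hc

/-! ### Independent sets in graph powers -/

section GraphPower

variable {V : Type*}

/-- An independent set in a graph power is coloured without monochromatic cliques by coordinates
in which two of its points are distinct and not adjacent. -/
lemma indepNum_graphPower_lt [Finite V] {G : SimpleGraph V} {n k : ℕ} (hn : 0 < n) (hk : 2 ≤ k)
    (hG : G.indepNum < k) : (graphPower G n).indepNum < diagRamsey n k := by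
  classical
  have : Nonempty (Fin n) := ⟨⟨0, hn⟩⟩
  obtain ⟨s, hs⟩ := (graphPower G n).exists_isNIndepSet_indepNum
  let P : (Fin n → V) → (Fin n → V) → Fin n → Prop := fun x y i => x i ≠ y i ∧ ¬ G.Adj (x i) (y i)
  -- Equality of the predicates themselves makes the coordinate chosen by `Classical.epsilon`
  -- symmetric in `x` and `y`.
  have hP : ∀ x y, P x y = P y x := fun x y => by
    funext i
    simp only [P, ne_comm (a := x i), G.adj_comm (x i)]
  have hspec : ∀ x ∈ s, ∀ y ∈ s, x ≠ y → P x y (Classical.epsilon (P x y)) := by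
    intro x hx y hy hxy
    apply Classical.epsilon_spec (p := P x y)
    by_contra! h
    refine hs.isIndepSet hx hy hxy ⟨hxy, fun i => ?_⟩
    by_contra! h'
    exact h i h'
  have hf : MonoCliqueFree k (fun x y : s => Classical.epsilon (P x y)) := by
    refine ⟨fun x y => by rw [hP], fun i T hT hmono => ?_⟩
    have key : ∀ x ∈ T, ∀ y ∈ T, x ≠ y → P x y i := fun x hx y hy hxy =>
      hmono x hx y hy hxy ▸ hspec x x.2 y y.2 (fun h => hxy (Subtype.ext h))
    have hinj : Set.InjOn (fun x : s => x.1 i) T := by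
      intro x hx y hy hxy
      by_contra hne
      exact (key x hx y hy hne).1 hxy
    have hind : G.IsIndepSet (T.image fun x : s => x.1 i : Finset V) := by
      intro a ha b hb hab
      obtain ⟨x, hx, rfl⟩ := Finset.mem_image.1 ha
      obtain ⟨y, hy, rfl⟩ := Finset.mem_image.1 hb
      exact (key x hx y hy (fun h => hab (h ▸ rfl))).2
    have := hind.card_le_indepNum
    rw [Finset.card_image_of_injOn hinj, hT] at this
    omega
  exact (hf.hasColoring hk (by simp) (by simp [hs.card_eq])).lt_diagRamsey hn hk

lemma indepNum_graphPower_mul_le [Finite V] (G : SimpleGraph V) (m n : ℕ) :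
    (graphPower G m).indepNum * (graphPower G n).indepNum ≤ (graphPower G (m + n)).indepNum := by
  classical
  obtain ⟨s, hs⟩ := (graphPower G m).exists_isNIndepSet_indepNum
  obtain ⟨t, ht⟩ := (graphPower G n).exists_isNIndepSet_indepNum
  have happ : ∀ (x x' : Fin m → V) (y y' : Fin n → V), Fin.append x y = Fin.append x' y' →
      x = x' ∧ y = y' := by
    intro x x' y y' h
    constructor
    · funext i
      simpa using congrFun h (Fin.castAdd n i)
    · funext i
      simpa using congrFun h (Fin.natAdd m i)
  have hind : (graphPower G (m + n)).IsIndepSet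
      ((s ×ˢ t).image fun x => Fin.append x.1 x.2 : Finset (Fin (m + n) → V)) := by
    intro a ha b hb hab hadj
    obtain ⟨⟨x, y⟩, hx, rfl⟩ := Finset.mem_image.1 ha
    obtain ⟨⟨x', y'⟩, hx', rfl⟩ := Finset.mem_image.1 hb
    rw [Finset.mem_product] at hx hx'
    have hxx : x = x' := by
      by_contra hne
      exact hs.isIndepSet hx.1 hx'.1 hne
        ⟨hne, fun i => by simpa using hadj.2 (Fin.castAdd n i)⟩
    have hyy : y = y' := by
      by_contra hne
      exact ht.isIndepSet hx.2 hx'.2 hne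
        ⟨hne, fun i => by simpa using hadj.2 (Fin.natAdd m i)⟩
    exact hab (by rw [hxx, hyy])
  have := hind.card_le_indepNum
  rwa [Finset.card_image_of_injective _ (by
    rintro ⟨x, y⟩ ⟨x', y'⟩ h
    exact Prod.ext_iff.2 (happ x x' y y' h)), Finset.card_product, hs.card_eq, ht.card_eq] at this

lemma indepNum_pos [Finite V] [Nonempty V] (G : SimpleGraph V) : 0 < G.indepNum := by
  obtain ⟨v⟩ := ‹Nonempty V›
  have : G.IsIndepSet ({v} : Finset V) := by simp [SimpleGraph.IsIndepSet]
  exact Nat.lt_of_lt_of_le (by simp) this.card_le_indepNum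

/-- By supermultiplicativity the roots converge to their supremum over `n ≥ 1`, so `limUnder` is a
genuine limit that bounds each root. -/
lemma indepRoot_le_shannonCapacity [Finite V] [Nonempty V] (G : SimpleGraph V) {n : ℕ}
    (hn : 0 < n) : indepRoot G n ≤ shannonCapacity G := by
  have hpow : ∀ m q N, q * m + 0 ≤ N →
      (graphPower G m).indepNum ^ q ≤ (graphPower G N).indepNum := by
    intro m q
    induction q with
    | zero => exact fun N _ => indepNum_pos (graphPower G N)
    | succ q ih =>
      intro N hN
      rw [add_mul] at hN
      have h1 := indepNum_graphPower_mul_le G (N - m) m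
      rw [Nat.sub_add_cancel (by omega)] at h1
      rw [pow_succ]
      exact (Nat.mul_le_mul_right _ (ih (N - m) (by omega))).trans h1
  have hlim : Tendsto (indepRoot G) atTop (𝓝 (⨆ n, indepRoot G (n + 1))) :=
    tendsto_iSup_of_eventually_lt fun m hm c hc => eventually_lt_rpow hm (hpow m) hc
  rw [shannonCapacity, hlim.limUnder_eq]
  obtain ⟨n, rfl⟩ := Nat.exists_eq_add_of_le' hn
  exact le_iSup (fun n => indepRoot G (n + 1)) n

end GraphPower

/-! ### Graphs built from colourings, and the supremum of capacities -/

/-- The join of the complements of the colour classes of a colouring and of an independent set of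
size `a`. -/
def colorJoin {s n : ℕ} (f : Fin s → Fin s → Fin n) (hf : ∀ x y, f x y = f y x) (a : ℕ) :
    SimpleGraph ((Fin n × Fin s) ⊕ Fin a) where
  Adj
    | .inl (i, x), .inl (j, y) => i ≠ j ∨ x ≠ y ∧ f x y ≠ i
    | .inl _, .inr _ => True
    | .inr _, .inl _ => True
    | .inr _, .inr _ => False
  symm := ⟨by
    rintro (⟨i, x⟩ | u) (⟨j, y⟩ | v) h
    · by_cases hij : i = j
      · subst hij
        simp only [ne_eq, not_true_eq_false, false_or] at h ⊢
        exact ⟨fun e => h.1 e.symm, hf x y ▸ h.2⟩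
      · exact Or.inl (Ne.symm hij)
    all_goals exact h⟩
  loopless := ⟨by rintro (⟨i, x⟩ | u) h <;> simp at h⟩

/-- An independent set of a join lies within one part. In the part of colour `i` it is a
monochromatic clique, hence has fewer than `k` vertices; the added independent part makes the value
exactly `k - 1`. -/
lemma indepNum_colorJoin {s n k : ℕ} {f : Fin s → Fin s → Fin n} (hk : 0 < k)
    (hf : MonoCliqueFree k f) : (colorJoin f hf.symm (k - 1)).indepNum = k - 1 := by
  classical
  apply le_antisymm
  · by_contra! hlt
    obtain ⟨T, hT⟩ := (colorJoin f hf.symm (k - 1)).exists_isNIndepSet_indepNum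
    by_cases hr : ∃ u, Sum.inr u ∈ T
    · obtain ⟨u, hu⟩ := hr
      have hsub : T ⊆ Finset.univ.map Function.Embedding.inr := by
        rintro (x | v) hx
        · exact absurd trivial (hT.isIndepSet hx hu (by simp))
        · simp
      have := Finset.card_le_card hsub
      rw [hT.card_eq, Finset.card_map, Finset.card_univ, Fintype.card_fin] at this
      omega
    · push Not at hr
      have hinl : ∀ z ∈ T, ∃ i x, z = Sum.inl (i, x) := by
        rintro (⟨i, x⟩ | v) hz
        · exact ⟨i, x, rfl⟩
        · exact absurd hz (hr v)
      obtain ⟨T', hT'T, hT'⟩ := Finset.exists_subset_card_eq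
        (show k ≤ T.card by rw [hT.card_eq]; omega)
      obtain ⟨z, hz⟩ : T'.Nonempty := Finset.card_pos.1 (by omega)
      obtain ⟨i, x₀, rfl⟩ := hinl z (hT'T hz)
      have hsame : ∀ j x, Sum.inl (j, x) ∈ T → j = i := by
        intro j x hx
        by_contra hne
        exact hT.isIndepSet hx (hT'T hz) (by simp [hne]) (Or.inl hne)
      let S : Finset (Fin s) := Finset.univ.filter fun x => Sum.inl (i, x) ∈ T'
      have hST : S.map ⟨fun x => (Sum.inl (i, x) : (Fin n × Fin s) ⊕ Fin (k - 1)),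
          fun x y h => by simpa using h⟩ = T' := by
        ext z
        rw [Finset.mem_map]
        constructor
        · rintro ⟨x, hx, rfl⟩
          exact (Finset.mem_filter.1 hx).2
        · intro hz'
          obtain ⟨j, x, rfl⟩ := hinl z (hT'T hz')
          obtain rfl := hsame j x (hT'T hz')
          exact ⟨x, Finset.mem_filter.2 ⟨Finset.mem_univ _, hz'⟩, rfl⟩
      refine hf.free i S (by rw [← hT', ← hST, Finset.card_map]) ?_
      intro x hx y hy hxy
      by_contra hne
      exact hT.isIndepSet (hT'T (Finset.mem_filter.1 hx).2) (hT'T (Finset.mem_filter.1 hy).2)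
        (by simpa using hxy) (Or.inr ⟨hxy, hne⟩)
  · have hind : (colorJoin f hf.symm (k - 1)).IsIndepSet
        (Finset.univ.map Function.Embedding.inr : Finset ((Fin n × Fin s) ⊕ Fin (k - 1))) := by
      intro a ha b hb _
      obtain ⟨u, -, rfl⟩ := Finset.mem_map.1 ha
      obtain ⟨v, -, rfl⟩ := Finset.mem_map.1 hb
      exact id
    simpa using hind.card_le_indepNum

/-- The diagonal points, with `i`-th coordinate `(i, x)`, are independent: those of `x` and `y` are
distinct and not adjacent in coordinate `f x y`. -/
lemma le_indepNum_graphPower_colorJoin {s n a : ℕ} (hn : 0 < n) (f : Fin s → Fin s → Fin n)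
    (hf : ∀ x y, f x y = f y x) : s ≤ (graphPower (colorJoin f hf a) n).indepNum := by
  classical
  let φ : Fin s ↪ (Fin n → (Fin n × Fin s) ⊕ Fin a) :=
    ⟨fun x i => Sum.inl (i, x), fun x y h => by simpa using congrFun h ⟨0, hn⟩⟩
  have hind : (graphPower (colorJoin f hf a) n).IsIndepSet
      (Finset.univ.map φ : Finset (Fin n → (Fin n × Fin s) ⊕ Fin a)) := by
    intro u hu v hv huv hadj
    obtain ⟨x, -, rfl⟩ := Finset.mem_map.1 hu
    obtain ⟨y, -, rfl⟩ := Finset.mem_map.1 hv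
    have hxy : x ≠ y := fun h => huv (h ▸ rfl)
    rcases hadj.2 (f x y) with h | h | h
    · exact hxy (congrArg Prod.snd (Sum.inl_injective h))
    · exact h rfl
    · exact h.2 rfl
  simpa using hind.card_le_indepNum

lemma rpow_pred_diagRamsey_le_capacitySup {n k : ℕ} (hn : 0 < n) (hk : 2 ≤ k) :
    ((diagRamsey n k - 1 : ℕ) : ℝ≥0∞) ^ (1 / (n : ℝ)) ≤ capacitySup (k - 1) := by
  obtain ⟨f, hf⟩ := (hasColoring_pred_diagRamsey hn hk).exists_monoCliqueFree hn
  have : Nonempty ((Fin n × Fin (diagRamsey n k - 1)) ⊕ Fin (k - 1)) :=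
    ⟨.inr ⟨0, by omega⟩⟩
  calc ((diagRamsey n k - 1 : ℕ) : ℝ≥0∞) ^ (1 / (n : ℝ))
      ≤ indepRoot (colorJoin f hf.symm (k - 1)) n :=
        ENNReal.rpow_le_rpow
          (by exact_mod_cast le_indepNum_graphPower_colorJoin hn f hf.symm) (by positivity)
    _ ≤ shannonCapacity (colorJoin f hf.symm (k - 1)) := indepRoot_le_shannonCapacity _ hn
    _ ≤ capacitySup (k - 1) :=
        le_sSup ⟨_, inferInstance, _, indepNum_colorJoin (by omega) hf, rfl⟩

/-- The capacities reach `(R_N(k) - 1) ^ (1/N)` for every `N ≥ 1`. The lost unit is harmless, since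
`C ^ q < R_N(k)` between integers gives `C ^ q ≤ R_N(k) - 1`. -/
lemma rpow_diagRamsey_lt_capacitySup {n k : ℕ} (hn : 0 < n) (hk : 3 ≤ k) :
    (diagRamsey n k : ℝ≥0∞) ^ (1 / (n : ℝ)) < capacitySup (k - 1) := by
  obtain ⟨C, m, e, hm, hlt, hpow⟩ := exists_pow_lt_diagRamsey hk hn
  refine hlt.trans_le (le_of_forall_lt fun c hc => ?_)
  have h := eventually_lt_rpow (a := fun N => diagRamsey N k - 1) hm
    (fun q N hN => Nat.le_sub_one_of_lt (hpow q N hN)) hc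
  obtain ⟨N, hN, hN'⟩ := (h.and (eventually_gt_atTop 0)).exists
  exact hN.trans_le (rpow_pred_diagRamsey_le_capacitySup hN' (by omega))

lemma capacitySup_le_capacitySupLE (a : ℕ) : capacitySup a ≤ capacitySupLE a :=
  sSup_le_sSup fun _ ⟨V, hV, G, hG, hx⟩ => ⟨V, hV, G, hG.le, hx⟩

/-- The comparison passes through `R_n(k)` and not through the capacity of `G`, so `G` may live in
any universe and have independence number below `k - 1`. -/
lemma indepRoot_lt_capacitySup {V : Type*} [Finite V] {G : SimpleGraph V} {n k : ℕ} (hk : 3 ≤ k)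
    (hn : 0 < n) (hG : G.indepNum ≤ k - 1) : indepRoot G n < capacitySup (k - 1) := by
  refine lt_of_le_of_lt (ENNReal.rpow_le_rpow ?_ (by positivity))
    (rpow_diagRamsey_lt_capacitySup hn hk)
  exact_mod_cast (indepNum_graphPower_lt hn (by omega) (by omega)).le

theorem theorem4 (k : ℕ) (hk : 3 ≤ k) :
    (∃ L : ℝ≥0∞,
      Tendsto (fun n : ℕ => (diagRamsey n k : ℝ≥0∞) ^ (1 / (n : ℝ))) atTop (𝓝 L) ∧
      ∀ n₀ : ℕ, 0 < n₀ → (diagRamsey n₀ k : ℝ≥0∞) ^ (1 / (n₀ : ℝ)) < L) ∧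
    (∀ (V : Type*) [Finite V] (G : SimpleGraph V) (n : ℕ), 0 < n →
      G.indepNum = k - 1 → indepRoot G n < capacitySup (k - 1)) ∧
    (∀ (V : Type*) [Finite V] (G : SimpleGraph V) (n : ℕ), 0 < n →
      G.indepNum ≤ k - 1 → indepRoot G n < capacitySupLE (k - 1)) := by
  refine ⟨⟨_, tendsto_iSup_of_eventually_lt ?_, ?_⟩, ?_, ?_⟩
  · intro n hn c hc
    obtain ⟨C, m, e, hm, hlt, hpow⟩ := exists_pow_lt_diagRamsey hk hn
    exact eventually_lt_rpow hm (fun q N hN => (hpow q N hN).le) (hc.trans hlt)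
  · intro n hn
    obtain ⟨C, m, e, hm, hlt, hpow⟩ := exists_pow_lt_diagRamsey hk hn
    refine hlt.trans_le (le_of_forall_lt fun c hc => ?_)
    obtain ⟨N, hN, hN'⟩ := ((eventually_lt_rpow hm (fun q N hN => (hpow q N hN).le) hc).and
      (eventually_gt_atTop 0)).exists
    obtain ⟨N, rfl⟩ := Nat.exists_eq_add_of_le' hN'
    exact hN.trans_le (le_iSup (fun n : ℕ =>
      (diagRamsey (n + 1) k : ℝ≥0∞) ^ (1 / ((n + 1 : ℕ) : ℝ))) N)
  · exact fun V _ G n hn hG => indepRoot_lt_capacitySup hk hn hG.le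
  · exact fun V _ G n hn hG =>
      (indepRoot_lt_capacitySup hk hn hG).trans_le (capacitySup_le_capacitySupLE _)
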